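/- Let an election with $m$ candidates and $n$ voters be an $n$-tuple $P=(V_1,\dots,V_n)$ of total orders (preferences) on the set of candidates $[m]=\{1,\dots,m\}$. The election is group-separable if every set $C'\subseteq[m]$ with at least two elements can be partitioned into two non-empty blocks $A$ and $B$ such that every voter either ranks all candidates of $A$ above all candidates of $B$ or ranks all candidates of $B$ above all candidates of $A$. For two total orders $T_1,T_2$ on $\{a,b,c,d\}$, each written as a word with the most preferred candidate first, the election contains the configuration $(T_1,T_2)$ if there are two distinct voters $i\ne j$ and an injective map $g:\{a,b,c,d\}\to[m]$ such that $V_i$ orders the candidates $g(a),g(b),g(c),g(d)$ as $T_1$ orders $a,b,c,d$, and $V_j$ orders them as $T_2$ does; otherwise it avoids $(T_1,T_2)$. The election is enriched group-separable if it is group-separable and avoids both configurations $(abcd,badc)$ and $(acbd,bdac)$. Let $f(m,n)$ be the number of enriched group-separable elections with $m$ candidates and $n$ voters. Then: 1. $f(3,n)=6\cdot 2^{n-1}(2^n-1)$ for all $n\ge 1$; 2. $f(4,n)=24\cdot 4^{n-1}(2^{n+1}-3)$ for all $n\ge 1$; 3. $f(5,n)=120\cdot 4^{n-1}(2^{2n+1}-2^{n+2}+1)$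 for all $n\ge 1$; 4. $f(m,2)=\dfrac{m!}{4}\left((2+\sqrt2)(2-\sqrt2)^m+(2-\sqrt2)(2+\sqrt2)^m\right)$ for all $m\ge 0$. -/

import Mathlib

/-- A profile of preferences with `n` voters on the set `C` of candidates: an `n`-tuple of total
orders on `C`. The pair of `C` and such a profile is an election. -/
abbrev Profile (C : Type*) (n : ℕ) : Type _ := Fin n → LinearOrder C

/-- In the total order `V`, candidate `x` is (strictly) preferred to candidate `y`. -/
def Prefers {C : Type*} (V : LinearOrder C) (x y : C) : Prop := V.lt y x

/-- The election `(C, P)` contains the configuration `(S, T)`. -/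
def ContainsConfiguration {C S : Type*} {n l : ℕ} (P : Profile C n) (T : Profile S l) : Prop :=
  ∃ (f : Fin l → Fin n) (g : S → C), Function.Injective f ∧ Function.Injective g ∧
    ∀ (x y : S) (i : Fin l), Prefers (T i) x y → Prefers (P (f i)) (g x) (g y)

/-- The election `(C, P)` avoids the configuration `(S, T)`. -/
def AvoidsConfiguration {C S : Type*} {n l : ℕ} (P : Profile C n) (T : Profile S l) : Prop :=
  ¬ ContainsConfiguration P T

/-- The total order that is written as the word `w 0, w 1, …, w (h - 1)`, the most preferred
candidate first. -/
@[reducible] def ballot {S : Type*} {h : ℕ} (w : Fin h ≃ S) : LinearOrder S :=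
  LinearOrder.lift' (fun x => OrderDual.toDual (w.symm x))
    (OrderDual.toDual.injective.comp w.symm.injective)

/-- In `ballot w`, earlier letters of the word `w` are preferred to later ones. -/
theorem prefers_ballot_iff {S : Type*} {h : ℕ} (w : Fin h ≃ S) (i j : Fin h) :
    Prefers (ballot w) (w i) (w j) ↔ i < j := by
  show w.symm (w i) < w.symm (w j) ↔ i < j
  simp

/-- Four candidates, named `a`, `b`, `c`, `d`. -/
inductive Cand4 : Type
  | a | b | c | d

/-- The word `abcd`. -/
def wordABCD : Fin 4 ≃ Cand4 where
  toFun := ![.a, .b, .c, .d]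
  invFun | .a => 0 | .b => 1 | .c => 2 | .d => 3
  left_inv := by decide
  right_inv x := by cases x <;> rfl

/-- The word `badc`. -/
def wordBADC : Fin 4 ≃ Cand4 where
  toFun := ![.b, .a, .d, .c]
  invFun | .b => 0 | .a => 1 | .d => 2 | .c => 3
  left_inv := by decide
  right_inv x := by cases x <;> rfl

/-- The word `acbd`. -/
def wordACBD : Fin 4 ≃ Cand4 where
  toFun := ![.a, .c, .b, .d]
  invFun | .a => 0 | .c => 1 | .b => 2 | .d => 3
  left_inv := by decide
  right_inv x := by cases x <;> rfl

/-- The word `bdac`. -/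
def wordBDAC : Fin 4 ≃ Cand4 where
  toFun := ![.b, .d, .a, .c]
  invFun | .b => 0 | .d => 1 | .a => 2 | .c => 3
  left_inv := by decide
  right_inv x := by cases x <;> rfl

/-- An election is group-separable if every set `C'` of at least two candidates can be partitioned
into two (non-empty) blocks `A` and `B` such that every voter ranks all of `A` above all of `B`, or
all of `B` above all of `A`. -/
def IsGroupSeparable {C : Type*} {n : ℕ} (P : Profile C n) : Prop :=
  ∀ C' : Set C, C'.Nontrivial → ∃ A B : Set C, A.Nonempty ∧ B.Nonempty ∧ Disjoint A B ∧
    A ∪ B = C' ∧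
    ∀ i : Fin n, (∀ x ∈ A, ∀ y ∈ B, Prefers (P i) x y) ∨ (∀ x ∈ A, ∀ y ∈ B, Prefers (P i) y x)

/-- An election is enriched group-separable if it is group-separable and avoids the
configurations `(abcd, badc)` and `(acbd, bdac)`. -/
def IsEnrichedGroupSeparable {C : Type*} {n : ℕ} (P : Profile C n) : Prop :=
  IsGroupSeparable P ∧
    AvoidsConfiguration P ![ballot wordABCD, ballot wordBADC] ∧
    AvoidsConfiguration P ![ballot wordACBD, ballot wordBDAC]

/-- The number `f(m, n)` of enriched group-separable elections with set of candidates
`{1, …, m}` and `n` voters. -/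
noncomputable def numEnriched (m n : ℕ) : ℕ :=
  Nat.card {P : Profile (Fin m) n // IsEnrichedGroupSeparable P}

/-! An election is enriched group-separable exactly when every non-empty set of candidates has a
polar member, one that each voter ranks first or last in that set (`isEnrichedGroupSeparable_iff`).
A polar candidate can be split off as a block, and it rules out both configurations since in each of
them the extreme letters of one word are the middle letters of the other. Conversely, given blocks
`A` and `B`, the two avoided configurations force all voters to agree, up to reversal according to
which block is on top, on the order inside `A` or inside `B`; the outermost candidate of that block
is polar.

Counting is inclusion-exclusion over the polar candidates of the whole set, split by whether the
first voter ranks them first or last. There is at most one of each kind, so the events overlap only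
in pairs of one of each. This gives a two-term recurrence in the number of candidates
(`ncard_polarProfiles_recurrence`), from which all four formulas follow. -/

/-- Candidate `x` is, for each voter, the top or the bottom one of the candidates in `S`. -/
def IsPolarOn {C : Type*} {n : ℕ} (R : Fin n → C → C → Prop) (S : Set C) (x : C) : Prop :=
  ∀ i, (∀ y ∈ S, y ≠ x → R i x y) ∨ (∀ y ∈ S, y ≠ x → R i y x)

/-- Every non-empty set of candidates has a candidate that every voter ranks first or last. -/
def IsHereditarilyPolar {C : Type*} {n : ℕ} (R : Fin n → C → C → Prop) : Prop :=
  ∀ S : Set C, S.Nonempty → ∃ x ∈ S, IsPolarOn R S x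

/-! ### Enriched group-separability as hereditary polarity. -/

section Prefers

variable {C : Type*} {n : ℕ}

theorem prefers_irrefl (V : LinearOrder C) (x : C) : ¬ Prefers V x x := fun h => lt_irrefl x h

theorem Prefers.trans {V : LinearOrder C} {x y z : C} (hxy : Prefers V x y) (hyz : Prefers V y z) :
    Prefers V x z := lt_trans (α := C) hyz hxy

theorem Prefers.asymm {V : LinearOrder C} {x y : C} (hxy : Prefers V x y) : ¬ Prefers V y x :=
  fun h => prefers_irrefl V x (hxy.trans h)

theorem Prefers.ne {V : LinearOrder C} {x y : C} (hxy : Prefers V x y) : x ≠ y := by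
  rintro rfl
  exact prefers_irrefl V _ hxy

theorem prefers_or_prefers (V : LinearOrder C) {x y : C} (h : x ≠ y) :
    Prefers V x y ∨ Prefers V y x := (lt_or_gt_of_ne h).symm

theorem not_prefers_iff (V : LinearOrder C) {x y : C} (h : x ≠ y) :
    ¬ Prefers V x y ↔ Prefers V y x :=
  ⟨(prefers_or_prefers V h).resolve_left, Prefers.asymm⟩

theorem exists_prefers_all [Finite C] (V : LinearOrder C) {A : Set C} (hA : A.Nonempty) :
    ∃ a ∈ A, ∀ y ∈ A, y ≠ a → Prefers V a y := by
  obtain ⟨a, ha, h⟩ := Set.exists_max_image A id A.toFinite hA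
  exact ⟨a, ha, fun y hy hne => lt_of_le_of_ne (h y hy) hne⟩

theorem exists_all_prefers [Finite C] (V : LinearOrder C) {A : Set C} (hA : A.Nonempty) :
    ∃ a ∈ A, ∀ y ∈ A, y ≠ a → Prefers V y a := by
  obtain ⟨a, ha, h⟩ := Set.exists_min_image A id A.toFinite hA
  exact ⟨a, ha, fun y hy hne => lt_of_le_of_ne (h y hy) hne.symm⟩

/-- The letters of two words on `a, b, c, d`, realized by two voters. -/
theorem containsConfiguration_of_words {P : Profile C n} {v w : Fin 4 ≃ Cand4} {i j : Fin n}
    (hij : i ≠ j) (g : Cand4 → C)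
    (hi : Prefers (P i) (g (v 0)) (g (v 1)) ∧ Prefers (P i) (g (v 1)) (g (v 2)) ∧
      Prefers (P i) (g (v 2)) (g (v 3)))
    (hj : Prefers (P j) (g (w 0)) (g (w 1)) ∧ Prefers (P j) (g (w 1)) (g (w 2)) ∧
      Prefers (P j) (g (w 2)) (g (w 3))) :
    ContainsConfiguration P ![ballot v, ballot w] := by
  have mono : ∀ (V : LinearOrder C) (u : Fin 4 ≃ Cand4),
      (Prefers V (g (u 0)) (g (u 1)) ∧ Prefers V (g (u 1)) (g (u 2)) ∧
        Prefers V (g (u 2)) (g (u 3))) →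
      ∀ x y, Prefers (ballot u) x y → Prefers V (g x) (g y) := by
    rintro V u ⟨h1, h2, h3⟩ x y hxy
    obtain ⟨k, rfl⟩ := u.surjective x
    obtain ⟨l, rfl⟩ := u.surjective y
    rw [prefers_ballot_iff] at hxy
    have h13 := h1.trans h2
    have h24 := h2.trans h3
    have h14 := h13.trans h3
    fin_cases k <;> fin_cases l <;> first | assumption | exact absurd hxy (by decide)
  refine ⟨![i, j], g, ?_, ?_, ?_⟩
  · intro k l h
    fin_cases k <;> fin_cases l <;> simp_all [eq_comm]
  · intro x y h
    by_contra hne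
    rcases prefers_or_prefers (ballot v) hne with h' | h'
    · exact (mono _ _ hi _ _ h').ne h
    · exact (mono _ _ hi _ _ h').ne h.symm
  · intro x y k
    fin_cases k
    · exact mono _ _ hi x y
    · exact mono _ _ hj x y

/-- Two words without a common extreme letter are avoided by hereditarily polar profiles. -/
theorem IsHereditarilyPolar.avoidsConfiguration {P : Profile C n}
    (hP : IsHereditarilyPolar fun i => Prefers (P i)) {v w : Fin 4 ≃ Cand4}
    (hvw : ∀ x, (x = v 0 ∨ x = v 3) → (x = w 1 ∨ x = w 2)) :
    AvoidsConfiguration P ![ballot v, ballot w] := by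
  rintro ⟨f, g, -, hg, h⟩
  obtain ⟨_, ⟨x, rfl⟩, hx⟩ := hP (Set.range g) ⟨g (v 0), v 0, rfl⟩
  have key : ∀ (k : Fin 2) (u : Fin 4 ≃ Cand4),
      (∀ x y, Prefers (ballot u) x y → Prefers (P (f k)) (g x) (g y)) → x = u 0 ∨ x = u 3 := by
    intro k u hu
    by_contra! hne
    have h0 : Prefers (P (f k)) (g (u 0)) (g x) := hu _ _ <| by
      obtain ⟨l, rfl⟩ := u.surjective x
      rw [prefers_ballot_iff]
      exact Fin.pos_iff_ne_zero.2 fun hl => hne.1 (hl ▸ rfl)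
    have h3 : Prefers (P (f k)) (g x) (g (u 3)) := hu _ _ <| by
      obtain ⟨l, rfl⟩ := u.surjective x
      rw [prefers_ballot_iff]
      exact lt_of_le_of_ne (Fin.le_last l) fun hl => hne.2 (hl ▸ rfl)
    rcases hx (f k) with hx | hx
    · exact h0.asymm (hx _ ⟨_, rfl⟩ h0.ne)
    · exact h3.asymm (hx _ ⟨_, rfl⟩ h3.ne.symm)
  have hv := key 0 v fun x y => h x y 0
  have hw := key 1 w fun x y => h x y 1
  rcases hw with hw | hw <;> rcases hvw x hv with hx | hx <;>
    exact absurd (w.injective (hw.symm.trans hx)) (by decide)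

theorem IsHereditarilyPolar.isGroupSeparable {P : Profile C n}
    (hP : IsHereditarilyPolar fun i => Prefers (P i)) : IsGroupSeparable P := by
  intro S hS
  obtain ⟨x, hxS, hx⟩ := hP S hS.nonempty
  obtain ⟨y, hyS, hyx⟩ := hS.exists_ne x
  refine ⟨{x}, S \ {x}, Set.singleton_nonempty x, ⟨y, hyS, hyx⟩, Set.disjoint_sdiff_right,
    by simpa using hxS, fun i => ?_⟩
  rcases hx i with h | h
  · left
    rintro _ rfl z hz
    exact h z hz.1 hz.2
  · right
    rintro _ rfl z hz
    exact h z hz.1 hz.2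

/-- If the voters order every pair in the block `A` in accordance with their order of the blocks
`A` and `B`, then some candidate of `A` is polar on the union. -/
theorem exists_isPolarOn_union [Finite C] {P : Profile C n} {A B : Set C} {t : Fin n → Prop}
    (hA : A.Nonempty) (ht : ∀ i, t i → ∀ x ∈ A, ∀ y ∈ B, Prefers (P i) x y)
    (ht' : ∀ i, ¬ t i → ∀ x ∈ A, ∀ y ∈ B, Prefers (P i) y x)
    (h : ∀ i j, ∀ a ∈ A, ∀ a' ∈ A, a ≠ a' →
      ((t i ↔ Prefers (P i) a a') ↔ (t j ↔ Prefers (P j) a a'))) :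
    ∃ x ∈ A, IsPolarOn (fun i => Prefers (P i)) (A ∪ B) x := by
  rcases isEmpty_or_nonempty (Fin n) with hn | ⟨⟨i₀⟩⟩
  · obtain ⟨a, ha⟩ := hA
    exact ⟨a, ha, fun i => hn.elim i⟩
  -- The candidate of `A` farthest from `B` for the voter `i₀`; consistency makes it farthest for
  -- all voters.
  obtain ⟨a, ha, h₀⟩ : ∃ a ∈ A, ∀ y ∈ A, y ≠ a → (t i₀ ↔ Prefers (P i₀) a y) := by
    by_cases hi : t i₀
    · obtain ⟨a, ha, h⟩ := exists_prefers_all (P i₀) hA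
      exact ⟨a, ha, fun y hy hne => iff_of_true hi (h y hy hne)⟩
    · obtain ⟨a, ha, h⟩ := exists_all_prefers (P i₀) hA
      exact ⟨a, ha, fun y hy hne => iff_of_false hi (h y hy hne).asymm⟩
  have h₁ : ∀ i, ∀ y ∈ A, y ≠ a → (t i ↔ Prefers (P i) a y) := fun i y hy hne =>
    (h i₀ i a ha y hy hne.symm).1 (h₀ y hy hne)
  refine ⟨a, ha, fun i => ?_⟩
  by_cases hi : t i
  · left
    rintro y (hy | hy) hne
    · exact (h₁ i y hy hne).1 hi
    · exact ht i hi a ha y hy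
  · right
    rintro y (hy | hy) hne
    · exact (not_prefers_iff _ hne.symm).1 fun h' => hi ((h₁ i y hy hne).2 h')
    · exact ht' i hi a ha y hy

/-- Two pairs of candidates in different blocks, two voters: one of the pairs is ordered in
accordance with the order of the blocks. -/
theorem IsEnrichedGroupSeparable.pair_consistent {P : Profile C n}
    (hP : IsEnrichedGroupSeparable P) {A B : Set C} {t : Fin n → Prop}
    (ht : ∀ i, t i → ∀ x ∈ A, ∀ y ∈ B, Prefers (P i) x y)
    (ht' : ∀ i, ¬ t i → ∀ x ∈ A, ∀ y ∈ B, Prefers (P i) y x) {a a' b b' : C}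
    (ha : a ∈ A) (ha' : a' ∈ A) (hb : b ∈ B) (hb' : b' ∈ B) (haa : a ≠ a') (hbb : b ≠ b')
    (i j : Fin n) :
    ((t i ↔ Prefers (P i) a a') ↔ (t j ↔ Prefers (P j) a a')) ∨
    ((t i ↔ Prefers (P i) b b') ↔ (t j ↔ Prefers (P j) b b')) := by
  -- The two avoided configurations in terms of four candidates and two voters.
  have conf₁ : ∀ (a b c d : C) (i j : Fin n),
      ¬ ((Prefers (P i) a b ∧ Prefers (P i) b c ∧ Prefers (P i) c d) ∧
        (Prefers (P j) b a ∧ Prefers (P j) a d ∧ Prefers (P j) d c)) := by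
    rintro a b c d i j ⟨h, h'⟩
    refine hP.2.1 (containsConfiguration_of_words (i := i) (j := j) ?_
      (fun | .a => a | .b => b | .c => c | .d => d) h h')
    rintro rfl
    exact h.1.asymm h'.1
  have conf₂ : ∀ (a b c d : C) (i j : Fin n),
      ¬ ((Prefers (P i) a c ∧ Prefers (P i) c b ∧ Prefers (P i) b d) ∧
        (Prefers (P j) b d ∧ Prefers (P j) d a ∧ Prefers (P j) a c)) := by
    rintro a b c d i j ⟨h, h'⟩
    refine hP.2.2 (containsConfiguration_of_words (i := i) (j := j) ?_
      (fun | .a => a | .b => b | .c => c | .d => d) h h')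
    rintro rfl
    exact (h.1.trans h.2.1).asymm (h'.1.trans h'.2.1)
  -- Pairs are named so that voter `i` prefers `a` to `a'` and `b` to `b'`. If `j` orders the blocks
  -- as `i` does, reversing both pairs gives `(abcd, badc)`; if `j` swaps the blocks, keeping both
  -- pairs gives `(acbd, bdac)`.
  have main : ∀ a ∈ A, ∀ a' ∈ A, ∀ b ∈ B, ∀ b' ∈ B, a ≠ a' → b ≠ b' → Prefers (P i) a a' →
      Prefers (P i) b b' → (t i ↔ t j) ∧ (Prefers (P j) a a' ∨ Prefers (P j) b b') ∨
        ¬ (t i ↔ t j) ∧ ¬ (Prefers (P j) a a' ∧ Prefers (P j) b b') := by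
    intro a ha a' ha' b hb b' hb' haa hbb h1 h2
    rw [← not_prefers_iff _ haa.symm, ← not_prefers_iff _ hbb.symm]
    have c1 := conf₁ a a' b b' i j
    have c2 := conf₁ b b' a a' i j
    have c3 := conf₂ a b a' b' i j
    have c4 := conf₂ b a b' a' i j
    have t1 := ht i
    have t2 := ht j
    have t3 := ht' i
    have t4 := ht' j
    have e1 := not_prefers_iff (P j) haa
    have e2 := not_prefers_iff (P j) hbb
    grind
  have m1 := main a ha a' ha' b hb b' hb' haa hbb
  have m2 := main a' ha' a ha b hb b' hb' haa.symm hbb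
  have m3 := main a ha a' ha' b' hb' b hb haa hbb.symm
  have m4 := main a' ha' a ha b' hb' b hb haa.symm hbb.symm
  have e1 := not_prefers_iff (P i) haa
  have e2 := not_prefers_iff (P i) hbb
  have e3 := not_prefers_iff (P j) haa
  have e4 := not_prefers_iff (P j) hbb
  clear conf₁ conf₂ main
  grind

/-- Any `k` differs in `u` from `i` or from `j`, so `v k` equals `v i` or `v j`, and these two are
equal. Thus one inconsistent pair in `A` makes every pair in `B` consistent for all voters. -/
theorem iff_of_forall_iff_or_iff {ι : Type*} {u v : ι → Prop}
    (h : ∀ i j, (u i ↔ u j) ∨ (v i ↔ v j)) {i j : ι} (hij : ¬ (u i ↔ u j)) (k l : ι) :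
    v k ↔ v l := by
  have key : ∀ k, v i ↔ v k := by
    intro k
    have h1 := h i j
    have h2 := h i k
    have h3 := h j k
    tauto
  exact (key k).symm.trans (key l)

theorem IsEnrichedGroupSeparable.isHereditarilyPolar [Finite C] {P : Profile C n}
    (hP : IsEnrichedGroupSeparable P) : IsHereditarilyPolar fun i => Prefers (P i) := by
  intro S hS
  rcases hS.exists_eq_singleton_or_nontrivial with ⟨x, rfl⟩ | hS
  · exact ⟨x, rfl, fun i => Or.inl fun y hy hne => absurd hy hne⟩
  obtain ⟨A, B, hA, hB, -, rfl, hAB⟩ := hP.1 S hS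
  obtain ⟨t, ht, ht'⟩ : ∃ t : Fin n → Prop, (∀ i, t i → ∀ x ∈ A, ∀ y ∈ B, Prefers (P i) x y) ∧
      ∀ i, ¬ t i → ∀ x ∈ A, ∀ y ∈ B, Prefers (P i) y x :=
    ⟨fun i => ∀ x ∈ A, ∀ y ∈ B, Prefers (P i) x y, fun _ h => h, fun i => (hAB i).resolve_left⟩
  by_cases h : ∀ i j, ∀ a ∈ A, ∀ a' ∈ A, a ≠ a' →
      ((t i ↔ Prefers (P i) a a') ↔ (t j ↔ Prefers (P j) a a'))
  · obtain ⟨x, hx, hpol⟩ := exists_isPolarOn_union hA ht ht' h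
    exact ⟨x, Or.inl hx, hpol⟩
  · simp only [not_forall] at h
    obtain ⟨i, j, a, ha, a', ha', haa, hne⟩ := h
    -- The blocks trade roles, so `t` is negated; this does not affect consistency between two
    -- voters.
    obtain ⟨x, hx, hpol⟩ := exists_isPolarOn_union (P := P) (t := fun i => ¬ t i) hB
      (fun i hi x hx y hy => ht' i hi y hy x hx)
      (fun i hi x hx y hy => ht i (not_not.1 hi) y hy x hx) (by
        intro k l b hb b' hb' hbb
        have key := iff_of_forall_iff_or_iff (u := fun i => (t i ↔ Prefers (P i) a a'))
          (v := fun i => (t i ↔ Prefers (P i) b b'))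
          (hP.pair_consistent ht ht' ha ha' hb hb' haa hbb) hne k l
        clear hne
        tauto)
    exact ⟨x, Or.inr hx, Set.union_comm A B ▸ hpol⟩

theorem isEnrichedGroupSeparable_iff [Finite C] {P : Profile C n} :
    IsEnrichedGroupSeparable P ↔ IsHereditarilyPolar fun i => Prefers (P i) :=
  ⟨fun h => h.isHereditarilyPolar, fun h =>
    ⟨h.isGroupSeparable, h.avoidsConfiguration (by rintro x (rfl | rfl) <;> simp [wordABCD, wordBADC]),
      h.avoidsConfiguration (by rintro x (rfl | rfl) <;> simp [wordACBD, wordBDAC])⟩⟩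

end Prefers

/-! ### Counting hereditarily polar profiles. -/

/-- `r x y` says that `x` is ranked above `y` in a total order. -/
def IsRanking {C : Type*} (r : C → C → Prop) : Prop :=
  (∀ x, ¬ r x x) ∧ (∀ x y z, r x y → r y z → r x z) ∧ ∀ x y, x ≠ y → r x y ∨ r y x

/-- The hereditarily polar profiles, each preference given as a relation. -/
def polarProfiles (C : Type*) (n : ℕ) : Set (Fin n → C → C → Prop) :=
  {R | (∀ i, IsRanking (R i)) ∧ IsHereditarilyPolar R}

/-- Candidate `x` is ranked first by the voters with `s i = true` and last by the others. -/
def IsPolarWith {C : Type*} {n : ℕ} (R : Fin n → C → C → Prop) (x : C) (s : Fin n → Bool) : Prop :=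
  ∀ i y, y ≠ x → (s i = true → R i x y) ∧ (s i = false → R i y x)

/-- Adding a new candidate that is ranked first by the voters with `s i = true` and last by the
others. -/
def addPolar {C : Type*} {n : ℕ} (s : Fin n → Bool) (R : Fin n → C → C → Prop) (i : Fin n) :
    Option C → Option C → Prop
  | none, none => False
  | none, some _ => s i = true
  | some _, none => s i = false
  | some x, some y => R i x y

/-- The profiles in which `x` is polar, ranked first by the first voter if `b = true` and last if
`b = false`. -/
def profilesWithPolar {D : Type*} (n : ℕ) (x : D) (b : Bool) : Set (Fin (n + 1) → D → D → Prop) :=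
  {R | R ∈ polarProfiles D (n + 1) ∧ ∃ s, s 0 = b ∧ IsPolarWith R x s}

section Count

variable {C D : Type*} {n : ℕ}

theorem IsRanking.asymm {r : C → C → Prop} (h : IsRanking r) {x y : C} (hxy : r x y) : ¬ r y x :=
  fun hyx => h.1 x (h.2.1 _ _ _ hxy hyx)

theorem isRanking_prefers (V : LinearOrder C) : IsRanking (Prefers V) :=
  ⟨prefers_irrefl V, fun _ _ _ => Prefers.trans, fun _ _ => prefers_or_prefers V⟩

theorem exists_prefers_eq {r : C → C → Prop} (h : IsRanking r) :
    ∃ V : LinearOrder C, Prefers V = r := by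
  classical
  have : IsStrictTotalOrder C (fun x y => r y x) :=
    { trichotomous := fun x y h1 h2 => by
        by_contra hne
        exact (h.2.2 x y hne).elim h2 h1
      irrefl := h.1
      trans := fun x y z h1 h2 => h.2.1 _ _ _ h2 h1 }
  exact ⟨linearOrderOfSTO (fun x y => r y x), rfl⟩

theorem prefers_injective : Function.Injective (Prefers (C := C)) := by
  intro V W h
  refine LinearOrder.ext_lt fun {x y} => ?_
  exact iff_of_eq (congrFun (congrFun h y) x)

theorem numEnriched_eq (m n : ℕ) : numEnriched m n = (polarProfiles (Fin m) n).ncard := by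
  rw [numEnriched, ← Nat.card_coe_set_eq]
  refine Nat.card_eq_of_bijective (fun P => ⟨fun i => Prefers (P.1 i), fun i =>
    isRanking_prefers _, isEnrichedGroupSeparable_iff.1 P.2⟩) ⟨?_, ?_⟩
  · intro P Q h
    exact Subtype.ext (funext fun i => prefers_injective (congrFun (congrArg Subtype.val h) i))
  · rintro ⟨R, hR⟩
    choose P hP using fun i => exists_prefers_eq (hR.1 i)
    obtain rfl : (fun i => Prefers (P i)) = R := funext hP
    exact ⟨⟨P, isEnrichedGroupSeparable_iff.2 hR.2⟩, rfl⟩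

theorem polarProfiles_eq_singleton [Subsingleton C] (n : ℕ) :
    polarProfiles C n = {fun _ _ _ => False} := by
  ext R
  simp only [Set.mem_singleton_iff]
  constructor
  · intro h
    funext i x y
    obtain rfl := Subsingleton.elim x y
    exact eq_false ((h.1 i).1 x)
  · rintro rfl
    exact ⟨fun i => ⟨fun _ h => h, fun _ _ _ h => h.elim,
      fun x y hne => (hne (Subsingleton.elim x y)).elim⟩,
      fun S ⟨x, hx⟩ => ⟨x, hx, fun i => Or.inl fun y _ hne => (hne (Subsingleton.elim y x)).elim⟩⟩

/-- Restriction of a profile along an injective map. -/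
theorem comap_mem_polarProfiles {R : Fin n → D → D → Prop} (hR : R ∈ polarProfiles D n)
    {f : C → D} (hf : Function.Injective f) :
    (fun i x y => R i (f x) (f y)) ∈ polarProfiles C n := by
  refine ⟨fun i => ⟨fun x => (hR.1 i).1 _, fun x y z => (hR.1 i).2.1 _ _ _,
    fun x y hne => (hR.1 i).2.2 _ _ (hf.ne hne)⟩, fun S hS => ?_⟩
  obtain ⟨_, ⟨x, hx, rfl⟩, h⟩ := hR.2 (f '' S) (hS.image f)
  exact ⟨x, hx, fun i => (h i).imp
    (fun h' y hy hne => h' _ (Set.mem_image_of_mem f hy) (hf.ne hne))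
    (fun h' y hy hne => h' _ (Set.mem_image_of_mem f hy) (hf.ne hne))⟩

theorem isPolarWith_addPolar (s : Fin n → Bool) (R : Fin n → C → C → Prop) :
    IsPolarWith (addPolar s R) none s := by
  intro i y hy
  cases y with
  | none => exact absurd rfl hy
  | some y => exact ⟨id, id⟩

theorem addPolar_mem_polarProfiles {s : Fin n → Bool} {R : Fin n → C → C → Prop}
    (hR : R ∈ polarProfiles C n) : addPolar s R ∈ polarProfiles (Option C) n := by
  refine ⟨fun i => ⟨?_, ?_, ?_⟩, fun S hS => ?_⟩
  · rintro (_ | x)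
    · exact id
    · exact (hR.1 i).1 x
  · rintro (_ | x) (_ | y) (_ | z) <;> simp only [addPolar] <;> try simp_all
    exact (hR.1 i).2.1 x y z
  · rintro (_ | x) (_ | y) hne <;> simp only [addPolar] <;> try simp_all
    exact (hR.1 i).2.2 x y hne
  · by_cases h : none ∈ S
    · refine ⟨none, h, fun i => ?_⟩
      cases hs : s i with
      | true => exact Or.inl fun y _ hy => (isPolarWith_addPolar s R i y hy).1 hs
      | false => exact Or.inr fun y _ hy => (isPolarWith_addPolar s R i y hy).2 hs
    · have hS' : (some ⁻¹' S).Nonempty := by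
        obtain ⟨_ | x, hx⟩ := hS
        · exact absurd hx h
        · exact ⟨x, hx⟩
      obtain ⟨x, hx, hpol⟩ := hR.2 _ hS'
      refine ⟨some x, hx, fun i => (hpol i).imp ?_ ?_⟩
      all_goals
        rintro h' (_ | y) hy hne
        · exact absurd hy h
        · exact h' y hy fun e => hne (congrArg some e)

theorem eq_addPolar {R : Fin n → Option C → Option C → Prop} (hR : ∀ i, IsRanking (R i))
    {s : Fin n → Bool} (h : IsPolarWith R none s) :
    R = addPolar s fun i x y => R i (some x) (some y) := by
  funext i x y
  cases x with
  | none =>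
    cases y with
    | none => exact eq_false ((hR i).1 none)
    | some y =>
      refine propext ⟨fun hy => ?_, (h i (some y) (Option.some_ne_none y)).1⟩
      refine Bool.of_not_eq_false fun hs => ?_
      exact (hR i).asymm hy ((h i (some y) (Option.some_ne_none y)).2 hs)
  | some x =>
    cases y with
    | none =>
      refine propext ⟨fun hx => ?_, (h i (some x) (Option.some_ne_none x)).2⟩
      refine Bool.of_not_eq_true fun hs => ?_
      exact (hR i).asymm hx ((h i (some x) (Option.some_ne_none x)).1 hs)
    | some y => rfl

theorem addPolar_right_injective {s s' : Fin n → Bool} {R R' : Fin n → C → C → Prop}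
    (h : addPolar s R = addPolar s' R') : R = R' := by
  funext i x y
  exact congrFun (congrFun (congrFun h i) (some x)) (some y)

/-- Some other candidate is needed to read off the signs: a lone candidate is both first and last.
-/
theorem addPolar_left_injective [Nonempty C] {s s' : Fin n → Bool} {R R' : Fin n → C → C → Prop}
    (h : addPolar s R = addPolar s' R') : s = s' := by
  obtain ⟨x⟩ := ‹Nonempty C›
  funext i
  exact Bool.eq_iff_iff.2 (iff_of_eq (congrFun (congrFun (congrFun h i) none) (some x)))

theorem comap_symm_injective (e : C ≃ D) :
    Function.Injective fun (R : Fin n → C → C → Prop) i x y => R i (e.symm x) (e.symm y) := by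
  intro R R' h
  funext i x y
  simpa using congrFun (congrFun (congrFun h i) (e x)) (e y)

theorem isPolarWith_comap_symm (e : C ≃ D) {R : Fin n → C → C → Prop} {x : C} {s : Fin n → Bool}
    (h : IsPolarWith R x s) : IsPolarWith (fun i x y => R i (e.symm x) (e.symm y)) (e x) s := by
  intro i y hy
  simpa using h i (e.symm y) fun h' => hy (by rw [← h', e.apply_symm_apply])

theorem isPolarWith_comap (e : C ≃ D) {R : Fin n → D → D → Prop} {x : C} {s : Fin n → Bool}
    (h : IsPolarWith R (e x) s) : IsPolarWith (fun i x y => R i (e x) (e y)) x s :=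
  fun i y hy => h i (e y) (e.injective.ne hy)

theorem ncard_bool_fun (n : ℕ) (b : Bool) : {s : Fin (n + 1) → Bool | s 0 = b}.ncard = 2 ^ n := by
  have h : {s : Fin (n + 1) → Bool | s 0 = b} =
      Set.range fun t : Fin n → Bool => (Fin.cons b t : Fin (n + 1) → Bool) := by
    ext s
    refine ⟨fun hs => ⟨Fin.tail s, ?_⟩, ?_⟩
    · rw [← show s 0 = b from hs]
      exact Fin.cons_self_tail s
    · rintro ⟨t, rfl⟩
      rfl
  rw [h, ← Nat.card_coe_set_eq, Nat.card_range_of_injective fun t t' h => (Fin.cons_inj.1 h).2]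
  simp

/-- Such a profile amounts to the signs of the voters other than the first and an arbitrary polar
profile of the remaining candidates. -/
theorem ncard_profilesWithPolar [Nonempty C] (e : Option C ≃ D) (b : Bool) :
    (profilesWithPolar n (e none) b).ncard = 2 ^ n * (polarProfiles C (n + 1)).ncard := by
  rw [← ncard_bool_fun n b, ← Set.ncard_prod]
  have himage : profilesWithPolar n (e none) b =
      (fun p : (Fin (n + 1) → Bool) × (Fin (n + 1) → C → C → Prop) =>
        fun i x y => addPolar p.1 p.2 i (e.symm x) (e.symm y)) ''
      ({s | s 0 = b} ×ˢ polarProfiles C (n + 1)) := by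
    ext R
    constructor
    · rintro ⟨hR, s, hs, h⟩
      have hR' := comap_mem_polarProfiles hR e.injective
      refine ⟨(s, fun i x y => R i (e (some x)) (e (some y))), ⟨hs,
        comap_mem_polarProfiles hR' (Option.some_injective C)⟩, ?_⟩
      have key := eq_addPolar hR'.1 (isPolarWith_comap e h)
      funext i x y
      simpa using (congrFun (congrFun (congrFun key i) (e.symm x)) (e.symm y)).symm
    · rintro ⟨⟨s, R⟩, ⟨hs, hR⟩, rfl⟩
      exact ⟨comap_mem_polarProfiles (addPolar_mem_polarProfiles hR) e.symm.injective, s, hs,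
        isPolarWith_comap_symm e (isPolarWith_addPolar s R)⟩
  rw [himage]
  refine Set.ncard_image_of_injective _ ?_
  rintro ⟨s, R⟩ ⟨s', R'⟩ h
  have h' := comap_symm_injective e h
  exact Prod.ext (addPolar_left_injective h') (addPolar_right_injective h')

/-- Two polar candidates occupy opposite ends for every voter, so the signs of one determine those
of the other and only one factor `2 ^ n` appears. -/
theorem ncard_profilesWithPolar_inter (e : Option (Option C) ≃ D) :
    (profilesWithPolar n (e none) true ∩ profilesWithPolar n (e (some none)) false).ncard =
      2 ^ n * (polarProfiles C (n + 1)).ncard := by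
  rw [← ncard_bool_fun n true, ← Set.ncard_prod]
  have himage : profilesWithPolar n (e none) true ∩ profilesWithPolar n (e (some none)) false =
      (fun p : (Fin (n + 1) → Bool) × (Fin (n + 1) → C → C → Prop) =>
        fun i x y => addPolar p.1 (addPolar (fun j => !p.1 j) p.2) i (e.symm x) (e.symm y)) ''
      ({s | s 0 = true} ×ˢ polarProfiles C (n + 1)) := by
    ext R
    constructor
    · rintro ⟨⟨hR, s, hs, h⟩, -, t, ht, h'⟩
      have hR' := comap_mem_polarProfiles hR e.injective
      have hR'' := comap_mem_polarProfiles hR' (Option.some_injective _)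
      refine ⟨(s, fun i x y => R i (e (some (some x))) (e (some (some y)))), ⟨hs,
        comap_mem_polarProfiles hR'' (Option.some_injective C)⟩, ?_⟩
      have hpol := isPolarWith_comap e h
      have hpol' := isPolarWith_comap e h'
      obtain rfl : t = fun j => !s j := by
        funext j
        have h1 := hpol j (some none) (Option.some_ne_none _)
        have h2 := hpol' j none (Option.some_ne_none _).symm
        have h3 : ∀ x y, R j (e x) (e y) → ¬ R j (e y) (e x) := fun x y => (hR'.1 j).asymm
        cases hsj : s j <;> cases htj : t j
        · exact absurd (h1.2 hsj) (h3 _ _ (h2.2 htj))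
        · rfl
        · rfl
        · exact absurd (h1.1 hsj) (h3 _ _ (h2.1 htj))
      have key := eq_addPolar hR'.1 hpol
      have key' := eq_addPolar hR''.1 (s := fun j => !s j) fun i y hy =>
        hpol' i (some y) fun h => hy (Option.some_injective _ h)
      rw [key'] at key
      funext i x y
      simpa using (congrFun (congrFun (congrFun key i) (e.symm x)) (e.symm y)).symm
    · rintro ⟨⟨s, R⟩, ⟨hs, hR⟩, rfl⟩
      have hmem := comap_mem_polarProfiles (addPolar_mem_polarProfiles (s := s)
        (addPolar_mem_polarProfiles (s := fun j => !s j) hR)) e.symm.injective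
      refine ⟨⟨hmem, s, hs, isPolarWith_comap_symm e (isPolarWith_addPolar s _)⟩,
        hmem, fun j => !s j, by simpa using hs, isPolarWith_comap_symm e ?_⟩
      intro i y hy
      rcases y with _ | y
      · exact ⟨fun h => by simpa [addPolar] using h, fun h => by simpa [addPolar] using h⟩
      · exact isPolarWith_addPolar (fun j => !s j) R i y fun h => hy (congrArg some h)
  rw [himage]
  refine Set.ncard_image_of_injective _ ?_
  rintro ⟨s, R⟩ ⟨s', R'⟩ h
  have h' := comap_symm_injective e h
  exact Prod.ext (addPolar_left_injective h')
    (addPolar_right_injective (addPolar_right_injective h'))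

theorem profilesWithPolar_eq_of_mem {x y : D} {b : Bool} {R : Fin (n + 1) → D → D → Prop}
    (hx : R ∈ profilesWithPolar n x b) (hy : R ∈ profilesWithPolar n y b) : x = y := by
  obtain ⟨hR, s, hs, h⟩ := hx
  obtain ⟨-, t, ht, h'⟩ := hy
  by_contra hne
  have h1 := h 0 y (Ne.symm hne)
  have h2 := h' 0 x hne
  cases b
  · exact (hR.1 0).asymm (h1.2 hs) (h2.2 ht)
  · exact (hR.1 0).asymm (h1.1 hs) (h2.1 ht)

theorem iUnion_profilesWithPolar_union [Nonempty D] :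
    (⋃ x : D, profilesWithPolar n x true) ∪ (⋃ x : D, profilesWithPolar n x false) =
      polarProfiles D (n + 1) := by
  classical
  ext R
  constructor
  · rintro (h | h) <;> obtain ⟨x, hx⟩ := Set.mem_iUnion.1 h <;> exact hx.1
  · intro hR
    obtain ⟨x, -, hx⟩ := hR.2 Set.univ Set.univ_nonempty
    -- If `x` is the only candidate, both cases hold vacuously and the sign defaults to `true`.
    set s : Fin (n + 1) → Bool := fun i => decide (∀ y, y ≠ x → R i x y) with hs
    have hpol : IsPolarWith R x s := by
      intro i y hy
      refine ⟨fun h => of_decide_eq_true h y hy, fun h => ?_⟩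
      exact (hx i).resolve_left (fun h' => of_decide_eq_false h fun z hz => h' z trivial hz)
        y trivial hy
    cases h0 : s 0
    · exact Or.inr (Set.mem_iUnion.2 ⟨x, hR, s, h0, hpol⟩)
    · exact Or.inl (Set.mem_iUnion.2 ⟨x, hR, s, h0, hpol⟩)

theorem iUnion_profilesWithPolar_inter [Nontrivial D] :
    (⋃ x : D, profilesWithPolar n x true) ∩ (⋃ x : D, profilesWithPolar n x false) =
      ⋃ p : {p : D × D // p.1 ≠ p.2},
        profilesWithPolar n p.1.1 true ∩ profilesWithPolar n p.1.2 false := by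
  ext R
  simp only [Set.mem_inter_iff, Set.mem_iUnion]
  constructor
  · rintro ⟨⟨x, hx⟩, y, hy⟩
    refine ⟨⟨(x, y), ?_⟩, hx, hy⟩
    rintro (rfl : x = y)
    obtain ⟨z, hz⟩ := exists_ne x
    obtain ⟨hR, s, hs, h⟩ := hx
    obtain ⟨-, t, ht, h'⟩ := hy
    exact (hR.1 0).asymm ((h 0 z hz).1 hs) ((h' 0 z hz).2 ht)
  · rintro ⟨p, hx, hy⟩
    exact ⟨⟨_, hx⟩, _, hy⟩

theorem ncard_iUnion_eq_mul {ι α : Type*} [Finite ι] [Finite α] {A : ι → Set α} {k : ℕ}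
    (hA : Pairwise (Function.onFun Disjoint A)) (hk : ∀ i, (A i).ncard = k) :
    (⋃ i, A i).ncard = Nat.card ι * k := by
  have := Fintype.ofFinite ι
  rw [← Nat.card_coe_set_eq, Nat.card_congr (Set.unionEqSigmaOfDisjoint hA), Nat.card_sigma]
  simp [Nat.card_coe_set_eq, hk]

/-- Inclusion-exclusion for the two events that some polar candidate is first, respectively last,
for the first voter. Each event is a disjoint union over candidates, and their intersection a
disjoint union over ordered pairs of distinct candidates. -/
theorem ncard_polarProfiles_recurrence (m n : ℕ) :
    (polarProfiles (Fin (m + 2)) (n + 1)).ncard +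
      (m + 2) * (m + 1) * (2 ^ n * (polarProfiles (Fin m) (n + 1)).ncard) =
    2 * ((m + 2) * (2 ^ n * (polarProfiles (Fin (m + 1)) (n + 1)).ncard)) := by
  have hU : ∀ b, (⋃ x : Fin (m + 2), profilesWithPolar n x b).ncard =
      (m + 2) * (2 ^ n * (polarProfiles (Fin (m + 1)) (n + 1)).ncard) := by
    intro b
    rw [ncard_iUnion_eq_mul (k := 2 ^ n * (polarProfiles (Fin (m + 1)) (n + 1)).ncard),
      Nat.card_fin]
    · exact fun x y hne => Set.disjoint_left.2 fun R hx hy =>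
        hne (profilesWithPolar_eq_of_mem hx hy)
    · intro x
      simpa using ncard_profilesWithPolar (n := n) (finSuccEquiv' x).symm b
  have hI : ((⋃ x : Fin (m + 2), profilesWithPolar n x true) ∩
      ⋃ x : Fin (m + 2), profilesWithPolar n x false).ncard =
      (m + 2) * (m + 1) * (2 ^ n * (polarProfiles (Fin m) (n + 1)).ncard) := by
    rw [iUnion_profilesWithPolar_inter,
      ncard_iUnion_eq_mul (k := 2 ^ n * (polarProfiles (Fin m) (n + 1)).ncard)]
    · congr 1
      rw [Nat.card_eq_fintype_card, Fintype.card_of_subtype Finset.univ.offDiag (by simp),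
        Finset.offDiag_card, Finset.card_univ, Fintype.card_fin, ← Nat.mul_sub_one]
      rfl
    · refine fun p q hne => Set.disjoint_left.2 fun R hp hq => hne (Subtype.ext (Prod.ext ?_ ?_))
      · exact profilesWithPolar_eq_of_mem hp.1 hq.1
      · exact profilesWithPolar_eq_of_mem hp.2 hq.2
    · rintro ⟨⟨x, y⟩, hne : x ≠ y⟩
      obtain ⟨z, rfl⟩ := Fin.exists_succAbove_eq (Ne.symm hne)
      -- The equivalence sets aside `x`, then `z`, the index of `y` among the candidates other than
      -- `x`.
      have key := ncard_profilesWithPolar_inter (n := n)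
        ((finSuccEquiv' z).symm.optionCongr.trans (finSuccEquiv' x).symm)
      have hz : ((finSuccEquiv' z).symm.optionCongr.trans (finSuccEquiv' x).symm) (some none) =
          x.succAbove z := by
        change (finSuccEquiv' x).symm (some ((finSuccEquiv' z).symm none)) = _
        simp
      have hx : ((finSuccEquiv' z).symm.optionCongr.trans (finSuccEquiv' x).symm) none = x :=
        finSuccEquiv'_symm_none x
      rwa [hx, hz] at key
  rw [← hI, ← iUnion_profilesWithPolar_union, Set.ncard_union_add_ncard_inter, hU, hU, two_mul]

end Count

/-! ### Closed forms from the recurrence. -/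

theorem numEnriched_recurrence (m n : ℕ) :
    (numEnriched (m + 2) (n + 1) : ℤ) =
      (m + 2) * 2 ^ n * (2 * numEnriched (m + 1) (n + 1) - (m + 1) * numEnriched m (n + 1)) := by
  have h := ncard_polarProfiles_recurrence m n
  simp only [← numEnriched_eq] at h
  zify at h
  linarith

theorem numEnriched_zero (n : ℕ) : numEnriched 0 n = 1 := by
  rw [numEnriched_eq, polarProfiles_eq_singleton, Set.ncard_singleton]

theorem numEnriched_one (n : ℕ) : numEnriched 1 n = 1 := by
  rw [numEnriched_eq, polarProfiles_eq_singleton, Set.ncard_singleton]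

theorem numEnriched_two (n : ℕ) : (numEnriched 2 (n + 1) : ℤ) = 2 * 2 ^ n := by
  have h := numEnriched_recurrence 0 n
  simp only [zero_add, numEnriched_zero, numEnriched_one] at h
  rw [h]
  push_cast
  ring

theorem numEnriched_three (n : ℕ) :
    (numEnriched 3 (n + 1) : ℤ) = 6 * 2 ^ n * (2 * 2 ^ n - 1) := by
  have h := numEnriched_recurrence 1 n
  norm_num only at h
  rw [h, numEnriched_two, numEnriched_one]
  push_cast
  ring

theorem numEnriched_four (n : ℕ) :
    (numEnriched 4 (n + 1) : ℤ) = 24 * (2 ^ n) ^ 2 * (4 * 2 ^ n - 3) := by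
  have h := numEnriched_recurrence 2 n
  norm_num only at h
  rw [h, numEnriched_three, numEnriched_two]
  ring

theorem numEnriched_five (n : ℕ) :
    (numEnriched 5 (n + 1) : ℤ) = 120 * (2 ^ n) ^ 2 * (8 * (2 ^ n) ^ 2 - 8 * 2 ^ n + 1) := by
  have h := numEnriched_recurrence 3 n
  norm_num only at h
  rw [h, numEnriched_four, numEnriched_three]
  ring

/-- For two voters, division by `m!` turns the recurrence into `g (m + 2) = 4 * g (m + 1) - 2 * g
m`, with characteristic roots `2 ± √2`. -/
theorem numEnriched_two_voters (m : ℕ) :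
    (numEnriched m 2 : ℝ) = (m.factorial : ℝ) / 4 *
      ((2 + √2) * (2 - √2) ^ m + (2 - √2) * (2 + √2) ^ m) := by
  have hsq : √2 ^ 2 = (2 : ℝ) := Real.sq_sqrt (by norm_num)
  induction m using Nat.twoStepInduction with
  | zero =>
    rw [numEnriched_zero]
    norm_num
  | one =>
    rw [numEnriched_one]
    norm_num
    linear_combination (1 / 2 : ℝ) * hsq
  | more m ih0 ih1 =>
    have h := numEnriched_recurrence m 1
    have hR : (numEnriched (m + 2) 2 : ℝ) =
        (m + 2) * 2 ^ 1 * (2 * numEnriched (m + 1) 2 - (m + 1) * numEnriched m 2) := by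
      exact_mod_cast h
    have e1 : (2 - √2) ^ 2 = 4 * (2 - √2) - 2 := by linear_combination hsq
    have e2 : (2 + √2) ^ 2 = 4 * (2 + √2) - 2 := by linear_combination hsq
    rw [hR, ih0, ih1, pow_add _ m 2, pow_add _ m 2, e1, e2, Nat.factorial_succ (m + 1),
      Nat.factorial_succ m]
    push_cast
    ring

theorem mainTheorem5 :
    (∀ n : ℕ, 1 ≤ n → (numEnriched 3 n : ℤ) = 6 * 2 ^ (n - 1) * (2 ^ n - 1)) ∧
    (∀ n : ℕ, 1 ≤ n → (numEnriched 4 n : ℤ) = 24 * 4 ^ (n - 1) * (2 ^ (n + 1) - 3)) ∧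
    (∀ n : ℕ, 1 ≤ n →
      (numEnriched 5 n : ℤ) = 120 * 4 ^ (n - 1) * (2 ^ (2 * n + 1) - 2 ^ (n + 2) + 1)) ∧
    (∀ m : ℕ, (numEnriched m 2 : ℝ) = (m.factorial : ℝ) / 4 *
      ((2 + √2) * (2 - √2) ^ m + (2 - √2) * (2 + √2) ^ m)) := by
  have h4 : ∀ n : ℕ, (4 : ℤ) ^ n = (2 ^ n) ^ 2 := fun n => by
    rw [← pow_mul, mul_comm, pow_mul]
    norm_num
  refine ⟨fun n hn => ?_, fun n hn => ?_, fun n hn => ?_, numEnriched_two_voters⟩ <;>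
    obtain ⟨k, rfl⟩ := Nat.exists_eq_add_of_le' hn <;> rw [Nat.add_sub_cancel]
  · rw [numEnriched_three]
    ring
  · rw [numEnriched_four, h4]
    ring
  · rw [numEnriched_five, h4]
    ring
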